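/- Let $F$ be a finite 4-regular multigraph (loops and parallel edges allowed; each edge consists of two half-edges). A circuit is a closed trail, up to cyclic permutation; a circuit partition of $F$ is a partition of $E(F)$ into pairwise edge-disjoint circuits; an Euler system of $F$ is a collection of Euler circuits, one in each connected component of $F$. A circuit partition $P$ determines at each vertex $v$ a transition $P(v)$, i.e. a partition of the four half-edges at $v$ into two pairs (single transitions), namely the pairs of half-edges that are consecutive on circuits of $P$. Let $C$ be an Euler system of $F$, with a chosen orientation of each circuit. For each vertex $v$ designate one of the two passages of $C$ through $v$ as $v^+$ and the other as $v^-$; let $v^+$ enter $v$ along the half-edge $h_v^1$ and leave along $h_v^2$, and let $v^-$ enter along $h_v^3$ and leave along $h_v^4$. The three transitions at $v$ are $$\phi_C(v)=\{\{h_v^1,h_v^2\},\{h_v^3,h_v^4\}\},\quad \chi_C(v)=\{\{h_v^1,h_v^4\},\{h_v^2,h_v^3\}\},\quad \psi_C(v)=\{\{h_v^1,h_v^3\},\{h_v^2,h_v^4\}\}.$$ For a circuit partition $P$, the touch-graph $Tch(P)$ has a vertex for each circuit of $P$ and an edge $e_v$ for each $v\in V(F)$; the two half-edges of $e_v$ are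 the two single transitions in $P(v)$, each incident on the vertex representing the circuit of $P$ that contains it. For a half-edge $h$ of $F$ let $\overline h$ be the single transition of $P$ containing $h$. A closed walk $W$ in $F$ induces a closed walk $\overline W$ in $Tch(P)$: each passage of $W$ through $v$, entering along $a$ and leaving along $b$, contributes the step along $e_v$ from $\overline a$ to $\overline b$ if $\overline a\ne\overline b$, and nothing if $\overline a=\overline b$. Direct $e_w$ so that its initial half-edge is $\overline{h_w^1}$. Let $C_1(C,v)$ be the closed walk that follows $C$ from $v^-$ (leaving along $h_v^4$) to $v^+$ (entering along $h_v^1$). Define the real $V(F)\times V(F)$ matrix $M^0_{\mathbb R}(C,P)$ by letting its $vw$ entry be the number of times that $\overline{C_1(C,v)}$ traverses $e_w$ in the chosen direction, minus the number of times it traverses $e_w$ in the opposite direction. Let $\mathcal I_{\mathbb R}(C)$ be the $V(F)\times V(F)$ matrix with zero diagonal whose $vw$ entry for $v\neq w$ is $1$ if $v,w$ occur on a circuit of $C$ in the cyclic order $v^+w^-v^-w^+$, is $-1$ if they occur in the cyclic order $v^+w^+v^-w^-$, and is $0$ otherwise. Let $\mathcal I_{\mathbb R}(C,P)$ be the submatrix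 of $\mathcal I_{\mathbb R}(C)$ whose rows and columns correspond to the vertices $v$ with $P(v)=\chi_C(v)$ (the determinant of the empty matrix is $1$). Let $P$ be a circuit partition of $F$ with $P(v)\neq\psi_C(v)$ for every $v\in V(F)$. Then, for every choice of the signs $v^\pm$, the following conditions are equivalent: 1. $P$ is an Euler system; 2. $\det M^0_{\mathbb R}(C,P)=1$; 3. $\det M^0_{\mathbb R}(C,P)\neq 0$; 4. $\det \mathcal I_{\mathbb R}(C,P)=1$; 5. $\det \mathcal I_{\mathbb R}(C,P)\neq 0$. -/

import Mathlib

/-- A graph (loops and multiple edges allowed) given by its half-edges. Every half-edge `h` is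
incident on the vertex `inc h`; every edge consists of two distinct half-edges `h` and `flip h`.
The half-edge `h` also stands for its edge, directed so that `h` is the initial half-edge and
`flip h` the terminal one. -/
structure HalfEdgeGraph (V H : Type*) where
  inc : H → V
  flip : H → H
  flip_flip : ∀ h, flip (flip h) = h
  flip_ne : ∀ h, flip h ≠ h

namespace HalfEdgeGraph

variable {V H : Type*}

/-- Every vertex has exactly four incident half-edges. -/
def IsFourRegular (F : HalfEdgeGraph V H) : Prop :=
  ∀ v, {h | F.inc h = v}.ncard = 4

/-- The edge to which a half-edge belongs. -/
def edge (F : HalfEdgeGraph V H) (h : H) : Sym2 H := s(h, F.flip h)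

def Adj (F : HalfEdgeGraph V H) (v w : V) : Prop :=
  ∃ h, F.inc h = v ∧ F.inc (F.flip h) = w

/-- Two vertices lie in the same connected component. -/
def Connected (F : HalfEdgeGraph V H) : V → V → Prop := Relation.EqvGen F.Adj

/-- A circuit, that is, a nonempty closed trail up to the choice of its starting point. It is
given by the cyclic list of the initial half-edges `h₁, …, hₖ` of its successive directed edges:
the terminal half-edge of each edge is incident on the same vertex as the initial half-edge of the
next one, and no edge is repeated. -/
def IsCircuit (F : HalfEdgeGraph V H) (c : Cycle H) : Prop :=
  c ≠ Cycle.nil ∧ c.Chain (fun h k => F.inc (F.flip h) = F.inc k) ∧ (c.map F.edge).Nodup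

/-- The edge of `h` is traversed by `c`, in one direction or the other. -/
def Traverses (F : HalfEdgeGraph V H) (c : Cycle H) (h : H) : Prop :=
  h ∈ c ∨ F.flip h ∈ c

/-- A circuit partition: a set of circuits such that every edge belongs to exactly one of them.
(Each circuit is listed with one of its two orientations.) -/
def IsCircuitPartition (F : HalfEdgeGraph V H) (P : Set (Cycle H)) : Prop :=
  (∀ c ∈ P, F.IsCircuit c) ∧ ∀ h, ∃! c, c ∈ P ∧ F.Traverses c h

/-- `c` is an Euler circuit of the connected component of the vertex `v`. -/
def IsEulerCircuitAt (F : HalfEdgeGraph V H) (v : V) (c : Cycle H) : Prop :=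
  F.IsCircuit c ∧ ∀ h, F.Traverses c h ↔ F.Connected v (F.inc h)

/-- An Euler system: a set of Euler circuits, one for each connected component. -/
def IsEulerSystem (F : HalfEdgeGraph V H) (C : Set (Cycle H)) : Prop :=
  (∀ c ∈ C, ∃ v, F.IsEulerCircuitAt v c) ∧ ∀ v, ∃! c, c ∈ C ∧ F.IsEulerCircuitAt v c

/-- Some circuit in the set `C` arrives at a vertex along the half-edge `a` and then immediately
leaves along the half-edge `b`. -/
def Passage (F : HalfEdgeGraph V H) (C : Set (Cycle H)) (a b : H) : Prop :=
  ∃ l : List H, ((F.flip a :: l : List H) : Cycle H) ∈ C ∧ (l ++ [F.flip a]).head? = some b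

/-- The transition of a circuit partition `P` at `v`: the set of the pairs of half-edges at `v`
(single transitions) that follow each other in a circuit of `P`. -/
def transition (F : HalfEdgeGraph V H) (P : Set (Cycle H)) (v : V) : Set (Sym2 H) :=
  {t | ∃ a b, F.inc a = v ∧ F.inc b = v ∧ F.Passage P a b ∧ t = s(a, b)}

/-- The circuits in `C` leave the vertex `inc h` along `h`. -/
def Leaves (_F : HalfEdgeGraph V H) (C : Set (Cycle H)) (h : H) : Prop := ∃ c ∈ C, h ∈ c

/-- The circuits in `C` arrive at the vertex `inc h` along `h`. -/
def Enters (F : HalfEdgeGraph V H) (C : Set (Cycle H)) (h : H) : Prop := ∃ c ∈ C, F.flip h ∈ c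

/-- The transition `φ_C(v)`: follow the circuit of `C`. -/
def phi (F : HalfEdgeGraph V H) (C : Set (Cycle H)) (v : V) : Set (Sym2 H) := F.transition C v

/-- The transition `χ_C(v)`: differ from the circuit of `C`, consistently with its orientation. -/
def chi (F : HalfEdgeGraph V H) (C : Set (Cycle H)) (v : V) : Set (Sym2 H) :=
  {t | ∃ a b, F.inc a = v ∧ F.inc b = v ∧ F.Enters C a ∧ F.Leaves C b ∧ ¬ F.Passage C a b ∧
    t = s(a, b)}

/-- The transition `ψ_C(v)`: the one that is not consistent with an orientation of the incident
circuit of `C`. It pairs the two half-edges along which `C` enters `v`, and the two along which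
`C` leaves `v`. -/
def psi (F : HalfEdgeGraph V H) (C : Set (Cycle H)) (v : V) : Set (Sym2 H) :=
  {t | ∃ a b, F.inc a = v ∧ F.inc b = v ∧ a ≠ b ∧
    ((F.Enters C a ∧ F.Enters C b) ∨ (F.Leaves C a ∧ F.Leaves C b)) ∧ t = s(a, b)}

/-- A signed version of `C`: at every vertex `v` one of the two passages of `C` through `v` is
designated `v⁺` and the other `v⁻`. The passage `v⁺` arrives along `h₁ v` and leaves along `h₂ v`;
the passage `v⁻` arrives along `h₃ v` and leaves along `h₄ v`. These are all the half-edges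
at `v`. -/
structure Signing (F : HalfEdgeGraph V H) (C : Set (Cycle H)) where
  h₁ : V → H
  h₂ : V → H
  h₃ : V → H
  h₄ : V → H
  incident : ∀ v h, F.inc h = v ↔ h = h₁ v ∨ h = h₂ v ∨ h = h₃ v ∨ h = h₄ v
  passage_plus : ∀ v, F.Passage C (h₁ v) (h₂ v)
  passage_minus : ∀ v, F.Passage C (h₃ v) (h₄ v)

/-- `l` lists the directed edges of the fundamental circuit `C₁(C,v)`: the part of a circuit of `C`
that starts with the passage `v⁻` (leaving along `h₄ v`) and ends with the passage `v⁺` (arriving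
along `h₁ v`). -/
def Signing.IsFundamental {F : HalfEdgeGraph V H} {C : Set (Cycle H)} (S : F.Signing C)
    (v : V) (l : List H) : Prop :=
  (∃ m : List H, ((l ++ m : List H) : Cycle H) ∈ C) ∧
    l.head? = some (S.h₄ v) ∧ l.getLast? = some (F.flip (S.h₁ v))

theorem IsEulerCircuitAt.change {F : HalfEdgeGraph V H} {u : V} {c : Cycle H}
    (hc : F.IsEulerCircuitAt u c) {h : H} (hh : F.Traverses c h) :
    F.IsEulerCircuitAt (F.inc h) c := by
  refine ⟨hc.1, fun k => ?_⟩
  have h1 : F.Connected u (F.inc h) := (hc.2 h).1 hh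
  rw [hc.2 k]
  exact ⟨fun h2 => .trans _ _ _ (.symm _ _ h1) h2, fun h2 => .trans _ _ _ h1 h2⟩

theorem Signing.exists_isFundamental {F : HalfEdgeGraph V H} {C : Set (Cycle H)}
    (hC : F.IsEulerSystem C) (S : F.Signing C) (v : V) : ∃ l, S.IsFundamental v l := by
  have i1 : F.inc (S.h₁ v) = v := (S.incident v _).2 (by simp)
  have i4 : F.inc (S.h₄ v) = v := (S.incident v _).2 (by simp)
  obtain ⟨p, hp, -⟩ := S.passage_plus v
  obtain ⟨q, hq, hq2⟩ := S.passage_minus v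
  have m4 : S.h₄ v ∈ ((F.flip (S.h₃ v) :: q : List H) : Cycle H) := by
    cases q with
    | nil => simp at hq2; simp [hq2]
    | cons a q => simp at hq2; simp [hq2]
  obtain ⟨u, hu⟩ := hC.1 _ hp
  obtain ⟨w, hw⟩ := hC.1 _ hq
  have hu1 := hu.change (h := S.h₁ v) (Or.inr (by simp))
  have hw1 := hw.change (h := S.h₄ v) (Or.inl m4)
  rw [i1] at hu1
  rw [i4] at hw1
  have e := (hC.2 v).unique ⟨hp, hu1⟩ ⟨hq, hw1⟩
  have m1 : F.flip (S.h₁ v) ∈ ((F.flip (S.h₃ v) :: q : List H) : Cycle H) := by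
    rw [← e]; simp
  rw [Cycle.mem_coe_iff] at m4 m1
  obtain ⟨s, t, hst⟩ := List.append_of_mem m4
  have hrot : ((F.flip (S.h₃ v) :: q : List H) : Cycle H) = ((S.h₄ v :: t) ++ s : List H) := by
    rw [hst, Cycle.coe_eq_coe]
    exact List.isRotated_append
  have m1' : F.flip (S.h₁ v) ∈ (S.h₄ v :: t) ++ s := by
    have : F.flip (S.h₁ v) ∈ ((F.flip (S.h₃ v) :: q : List H) : Cycle H) := m1
    rwa [hrot, Cycle.mem_coe_iff] at this
  obtain ⟨x, y, hxy⟩ := List.append_of_mem m1'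
  refine ⟨x ++ [F.flip (S.h₁ v)], ⟨y, ?_⟩, ?_, by simp⟩
  · rw [hrot, hxy] at hq
    simpa using hq
  · cases x with
    | nil => simp at hxy; simp [hxy.1]
    | cons b x => simp at hxy; simp [hxy.1]

/-- The fundamental circuit `C₁(C,v)`, as the list of its directed edges beginning at `v⁻`. -/
noncomputable def Signing.fundamental {F : HalfEdgeGraph V H} {C : Set (Cycle H)}
    (hC : F.IsEulerSystem C) (S : F.Signing C) (v : V) : List H :=
  (S.exists_isFundamental hC v).choose

/-- The touch-graph `Tch(P)` has an edge `e_v` for each vertex `v` of `F`, and the two half-edges of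
`e_v` are the two single transitions in `P(v)`. `touchHalfEdge P h` is the half-edge `π_P(h)` of
`Tch(P)` which is the single transition of `P` that contains the half-edge `h` of `F`
(formally, the singleton consisting of this single transition). -/
def touchHalfEdge (F : HalfEdgeGraph V H) (P : Set (Cycle H)) (h : H) : Set (Sym2 H) :=
  {t | t ∈ F.transition P (F.inc h) ∧ h ∈ t}

open Classical in
/-- The image in `Tch(P)` of the closed walk of `F` with list of directed edges `l`. Each passage
of the walk through a vertex `v`, arriving along `a` and leaving along `b`, gives the step
`(π_P(a), π_P(b))` along the edge `e_v` of `Tch(P)`, except that nothing is done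
if `π_P(a) = π_P(b)`. -/
noncomputable def touchWalk (F : HalfEdgeGraph V H) (P : Set (Cycle H)) (l : List H) :
    List (Set (Sym2 H) × Set (Sym2 H)) :=
  ((l.zip (l.rotate 1)).map
    (fun p => (F.touchHalfEdge P (F.flip p.1), F.touchHalfEdge P p.2))).filter
    (fun q => q.1 ≠ q.2)

open Classical in
/-- The vector `z_D(W)` of a walk `W` in `Tch(P)`, where `D` is the directed version in which the
edge `e_w` has initial half-edge `init w`: tally `+1` for each step along `e_w` in the `D` direction
and `-1` for each step along `e_w` in the opposite direction. -/
noncomputable def walkVector (init : V → Set (Sym2 H))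
    (W : List (Set (Sym2 H) × Set (Sym2 H))) (w : V) : ℝ :=
  (W.countP (fun q => q.1 = init w) : ℝ) - (W.countP (fun q => q.2 = init w) : ℝ)

/-- The matrix `M⁰_ℝ(C,P)` of a signed version of `C`: its `v` row is `z_D` of the image of
`C₁(C,v)` in `Tch(P)`, where the initial half-edge of `e_w` in `D` is the image of `h₁ w`. -/
noncomputable def Signing.stdMatrix {F : HalfEdgeGraph V H} {C : Set (Cycle H)}
    (hC : F.IsEulerSystem C) (S : F.Signing C) (P : Set (Cycle H)) : Matrix V V ℝ :=
  Matrix.of fun v w =>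
    walkVector (fun x => F.touchHalfEdge P (S.h₁ x)) (F.touchWalk P (S.fundamental hC v)) w

/-- The four given half-edges occur, as initial half-edges of directed edges, in this cyclic order
on a circuit in `C`. -/
def InOrder (_F : HalfEdgeGraph V H) (C : Set (Cycle H)) (a b c d : H) : Prop :=
  ∃ k l m n : List H, ((a :: k ++ b :: l ++ c :: m ++ d :: n : List H) : Cycle H) ∈ C

open Classical in
/-- The signed interlacement matrix `I_ℝ(C)`. The passage `v⁺` is the one that leaves along `h₂ v`,
and `v⁻` is the one that leaves along `h₄ v`. The `vw` entry is `1` if the order on `C` is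
`v⁺ w⁻ v⁻ w⁺`, it is `-1` if the order is `v⁺ w⁺ v⁻ w⁻`, and otherwise `v` and `w` are equal or not
interlaced, and it is `0`. -/
noncomputable def Signing.interlacement {F : HalfEdgeGraph V H} {C : Set (Cycle H)}
    (S : F.Signing C) : Matrix V V ℝ :=
  Matrix.of fun v w =>
    if v = w then 0
    else if F.InOrder C (S.h₂ v) (S.h₄ w) (S.h₄ v) (S.h₂ w) then 1
    else if F.InOrder C (S.h₂ v) (S.h₂ w) (S.h₄ v) (S.h₄ w) then -1
    else 0

/-- The matrix `I_ℝ(C,P)`: the submatrix of `I_ℝ(C)` whose rows and columns correspond to the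
vertices `v` with `P(v) = χ_C(v)`. -/
noncomputable def Signing.interlacementOf {F : HalfEdgeGraph V H} {C : Set (Cycle H)}
    (S : F.Signing C) (P : Set (Cycle H)) :
    Matrix {v // F.transition P v = F.chi C v} {v // F.transition P v = F.chi C v} ℝ :=
  S.interlacement.submatrix Subtype.val Subtype.val

end HalfEdgeGraph

section LinearAlgebra

open Matrix

/-- The matrix of the partial map that agrees with `τ` off `R` and is undefined on `R`. -/
def cutMatrix {X : Type*} [DecidableEq X] (τ : Equiv.Perm X) (R : X → Prop) [DecidablePred R] :
    Matrix X X ℝ :=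
  Matrix.of fun x y => if R x then 0 else if τ x = y then 1 else 0

theorem cutMatrix_mulVec {X : Type*} [Fintype X] [DecidableEq X] (τ : Equiv.Perm X) (R : X → Prop)
    [DecidablePred R] (f : X → ℝ) (x : X) :
    (cutMatrix τ R *ᵥ f) x = if R x then 0 else f (τ x) := by
  by_cases h : R x <;> simp [cutMatrix, mulVec, dotProduct, h]

theorem cutMatrix_pow_mulVec {X : Type*} [Fintype X] [DecidableEq X] (τ : Equiv.Perm X)
    (R : X → Prop) [DecidablePred R] (f : X → ℝ) (n : ℕ) (x : X)
    (h : ∃ k < n, R ((τ ^ k) x)) : ((cutMatrix τ R ^ n) *ᵥ f) x = 0 := by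
  induction n generalizing x with
  | zero => simp at h
  | succ n ih =>
    rw [pow_succ', ← mulVec_mulVec, cutMatrix_mulVec]
    split_ifs with hx
    · rfl
    · obtain ⟨k, hk, hR⟩ := h
      cases k with
      | zero => exact absurd hR hx
      | succ k => exact ih (τ x) ⟨k, by omega, by simpa [pow_succ] using hR⟩

theorem det_one_sub_of_isNilpotent {X : Type*} [Fintype X] [DecidableEq X] {N : Matrix X X ℝ}
    (h : IsNilpotent N) : (1 - N).det = 1 := by
  have h1 := (Matrix.isNilpotent_charpoly_sub_pow_of_isNilpotent h).eq_zero
  have h2 := Matrix.eval_charpoly N 1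
  rw [sub_eq_zero.1 h1] at h2
  simpa using h2.symm

theorem det_one_sub_cutMatrix_eq_one {X : Type*} [Fintype X] [DecidableEq X] (τ : Equiv.Perm X)
    (R : X → Prop) [DecidablePred R] (h : ∀ x, ∃ n : ℕ, R ((τ ^ n) x)) :
    (1 - cutMatrix τ R).det = 1 := by
  choose n hn using h
  apply det_one_sub_of_isNilpotent
  refine ⟨Finset.univ.sup n + 1, ?_⟩
  ext x y
  have := cutMatrix_pow_mulVec τ R (Pi.single y 1) (Finset.univ.sup n + 1) x
    ⟨n x, Nat.lt_succ_of_le (Finset.le_sup (Finset.mem_univ x)), hn x⟩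
  simpa using this

theorem det_one_sub_cutMatrix_eq_zero {X : Type*} [Fintype X] [DecidableEq X] (τ : Equiv.Perm X)
    (R : X → Prop) [DecidablePred R] {x : X} (h : ∀ y, τ.SameCycle x y → ¬ R y) :
    (1 - cutMatrix τ R).det = 0 := by
  classical
  apply Matrix.exists_mulVec_eq_zero_iff.1
  refine ⟨fun y => if τ.SameCycle x y then 1 else 0, fun h0 => ?_, ?_⟩
  · simpa [Equiv.Perm.SameCycle.refl] using congrFun h0 x
  · ext y
    rw [sub_mulVec, one_mulVec, Pi.sub_apply, cutMatrix_mulVec]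
    by_cases hy : τ.SameCycle x y
    · simp [hy, h y hy]
    · simp [hy]

theorem List.sum_map_eq_sum_count_mul {X : Type*} [Fintype X] [BEq X] [LawfulBEq X] (l : List X)
    (f : X → ℝ) : (l.map f).sum = ∑ x, (l.count x : ℝ) * f x := by
  classical
  induction l with
  | nil => simp
  | cons a l ih => simp [List.count_cons, add_mul, Finset.sum_add_distrib, ih, add_comm]

theorem Matrix.det_eq_det_submatrix_of_trivial_columns {V : Type*} [Fintype V] [DecidableEq V]
    (p : V → Prop) [DecidablePred p] (A : Matrix V V ℝ)
    (h : ∀ v w, ¬ p w → A v w = (1 : Matrix V V ℝ) v w) :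
    A.det = (A.submatrix (Subtype.val : {v // p v} → V) Subtype.val).det := by
  rw [Matrix.twoBlockTriangular_det' A p]
  · have : A.toSquareBlockProp (fun i => ¬ p i) = 1 := by
      ext i j
      rw [toSquareBlockProp_def, of_apply, h _ _ j.2]
      simp [Matrix.one_apply, Subtype.ext_iff]
    rw [this, det_one, mul_one]
    rfl
  · intro i hi j hj
    rw [h _ _ hj, Matrix.one_apply_ne]
    rintro rfl
    exact hj hi

variable {V : Type*} [Fintype V] [DecidableEq V]

/-- The matrix whose `v` row records how often each closed walk `xs v` arrives at the passage
`(w, true)`, minus how often it leaves along the passage `s (w, true)`. -/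
def passageMatrix (σ s : Equiv.Perm (V × Bool)) (xs : V → List (V × Bool)) : Matrix V V ℝ :=
  Matrix.of fun v w => ((xs v).map fun x =>
    ((if σ x = (w, true) then 1 else 0) - (if x = s (w, true) then 1 else 0) : ℝ)).sum

theorem det_one_sub_cutMatrix_mul (σ s : Equiv.Perm (V × Bool)) (xs : V → List (V × Bool))
    (ρ : V → V) (χ : V → Prop) [DecidablePred χ]
    (hs : ∀ x, s x = if χ x.1 then (x.1, !x.2) else x)
    (hρ : ∀ v, ρ (ρ v) = ρ v) (hσ : ∀ x, ρ (σ x).1 = ρ x.1)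
    (hxs : ∀ v, ∀ x ∈ xs v, ρ x.1 = ρ v)
    (htel : ∀ v, ∀ f : V × Bool → ℝ,
      ((xs v).map fun x => f x - f (σ x)).sum = f (v, false) - f (v, true))
    (hreach : ∀ x, ∃ n : ℕ, (σ ^ n) x = (ρ x.1, true)) :
    (∀ v w, ¬ χ w → passageMatrix σ s xs v w = (1 : Matrix V V ℝ) v w) ∧
    (1 - cutMatrix (s * σ) (fun x => x = (ρ x.1, true))).det =
      (2 - passageMatrix σ s xs - diagonal (fun v => if χ v then 2 else 0)).det := by
  set N := cutMatrix σ (fun x => x = (ρ x.1, true)) with hN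
  set N' := cutMatrix (s * σ) (fun x => x = (ρ x.1, true)) with hN'
  let L : Matrix V (V × Bool) ℝ := of fun v x => ((xs v).count x : ℝ)
  let W : Matrix (V × Bool) V ℝ := of fun x w =>
    (if x = (w, true) then 1 else 0) - (if x = s (w, true) then 1 else 0)
  let U : Matrix V (V × Bool) ℝ := of fun v x =>
    (if x = (v, false) then 1 else 0) - (if x = (v, true) then 1 else 0)
  let c : V → ℝ := fun v =>
    ((xs v).map fun x => if x = (ρ x.1, true) then (1 : ℝ) else 0).sum
  let E : Matrix V (V × Bool) ℝ := of fun v x => if ρ x.1 = ρ v then 1 else 0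
  let L' : Matrix V (V × Bool) ℝ := L - diagonal c * E
  have hA : passageMatrix σ s xs = 1 + L * W := by
    ext v w
    have h1 := htel v (fun x => if x = (w, true) then 1 else 0)
    have h2 : (L * W) v w = ((xs v).map fun x => W x w).sum := by
      rw [List.sum_map_eq_sum_count_mul, mul_apply]
      rfl
    rw [Matrix.add_apply, h2]
    have h3 : (1 : Matrix V V ℝ) v w =
        -((xs v).map fun x => (if x = (w, true) then 1 else 0) -
          (if σ x = (w, true) then (1 : ℝ) else 0)).sum := by
      rw [h1]
      simp [Matrix.one_apply]
    rw [h3]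
    rw [neg_add_eq_sub, eq_sub_iff_add_eq, passageMatrix, of_apply, ← List.sum_map_add]
    simp only [W, of_apply]
    congr 1
    exact List.map_congr_left fun x _ => by ring
  have hEW : E * W = 0 := by
    ext v w
    simp [mul_apply, E, W, mul_sub, Finset.sum_sub_distrib, hs]
    split_ifs <;> simp_all
  have hL'W : L' * W = L * W := by
    simp [L', Matrix.sub_mul, Matrix.mul_assoc, hEW]
  have hUW : U * W = - diagonal (fun v => if χ v then 2 else 0) := by
    ext v w
    simp only [mul_apply, U, W, of_apply, sub_mul, ite_mul, one_mul, zero_mul,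
      Finset.sum_sub_distrib, Finset.sum_ite_eq', Finset.mem_univ, if_true, hs,
      Matrix.neg_apply, diagonal_apply]
    by_cases hw : χ w
    · by_cases hvw : v = w
      · subst hvw; simp [hw]; norm_num
      · simp [hw, hvw]
    · by_cases hvw : v = w
      · subst hvw; simp [hw]
      · simp [hw, hvw]
  have hcut : N' = N + N * (W * U) := by
    have h1 : (1 : Matrix (V × Bool) (V × Bool) ℝ) + W * U =
        of fun x y => if s x = y then 1 else 0 := by
      ext ⟨v, b⟩ ⟨w, d⟩
      rw [Matrix.add_apply, mul_apply, Matrix.one_apply]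
      simp only [U, W, of_apply, hs]
      rw [Finset.sum_eq_single v]
      · by_cases hv : χ v <;> by_cases hvw : v = w <;> cases b <;> cases d <;> simp [hv, hvw, eq_comm] <;>
            split_ifs <;> simp
      · intro u _ hu
        by_cases hχ : χ u <;> simp [hχ, hu.symm]
      · simp
    have h2 : N + N * (W * U) = N * (1 + W * U) := by rw [Matrix.mul_add, Matrix.mul_one]
    rw [h2, h1]
    ext x y
    rw [hN, hN', mul_apply]
    by_cases h : x = (ρ x.1, true)
    · simp only [cutMatrix, of_apply, if_pos h]; simp
    · simp only [cutMatrix, of_apply, if_neg h]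
      rw [Finset.sum_eq_single (σ x)] <;> simp +contextual [eq_comm]
  have hK : L' * (1 - N) = U := by
    have hmv : ∀ (B : Matrix V (V × Bool) ℝ) v y, (B * (1 - N) : Matrix V (V × Bool) ℝ) v y =
        ∑ x, B v x * ((Pi.single y 1 : V × Bool → ℝ) x -
          (if x = (ρ x.1, true) then 0 else (Pi.single y 1 : V × Bool → ℝ) (σ x))) := by
      intro B v y
      rw [mul_apply]
      refine Finset.sum_congr rfl fun x _ => ?_
      rw [Matrix.sub_apply]
      simp only [hN, cutMatrix, of_apply, Pi.single_apply, Matrix.one_apply]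
    ext v y
    rw [Matrix.sub_mul, Matrix.sub_apply, Matrix.mul_assoc, diagonal_mul, hmv, hmv]
    set f : V × Bool → ℝ := Pi.single y 1 with hf
    have e1 : ∑ x, L v x * (f x - (if x = (ρ x.1, true) then 0 else f (σ x))) =
        f (v, false) - f (v, true) + c v * f (σ (ρ v, true)) := by
      rw [← htel]
      change ∑ x, ((xs v).count x : ℝ) * _ = _
      rw [← List.sum_map_eq_sum_count_mul, ← List.sum_map_mul_right, ← List.sum_map_add]
      congr 1
      refine List.map_congr_left fun x hx => ?_
      have hx' := hxs v x hx
      by_cases h : x = (ρ x.1, true)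
      · rw [if_pos h, if_pos h, ← hx', ← h]; ring
      · rw [if_neg h, if_neg h]; ring
    have e2 : ∑ x, E v x * (f x - (if x = (ρ x.1, true) then 0 else f (σ x))) =
        f (σ (ρ v, true)) := by
      have e3 : ∀ x, E v x * (f x - (if x = (ρ x.1, true) then 0 else f (σ x))) =
          E v x * f x - E v (σ x) * f (σ x) + (if x = (ρ v, true) then f (σ (ρ v, true)) else 0) := by
        intro x
        simp only [E, of_apply, hσ]
        by_cases h1 : ρ x.1 = ρ v
        · rw [h1]; simp only [if_true, one_mul]
          by_cases h : x = (ρ v, true)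
          · rw [if_pos h, if_pos h, ← h]; ring
          · rw [if_neg h, if_neg h]; ring
        · have : x ≠ (ρ v, true) := by
            rintro rfl; exact h1 (hρ v)
          simp [h1, this]
      rw [Finset.sum_congr rfl fun x _ => e3 x, Finset.sum_add_distrib, Finset.sum_sub_distrib,
        Equiv.sum_comp σ (fun x => E v x * f x)]
      simp
    rw [e1, e2]
    simp only [U, of_apply, hf, Pi.single_apply, eq_comm (a := y)]
    ring
  have hdet : (1 - N).det = 1 :=
    det_one_sub_cutMatrix_eq_one _ _ fun x => by
      obtain ⟨n, hn⟩ := hreach x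
      exact ⟨n, by simp only [hn, hρ]⟩
  refine ⟨fun v w hw => ?_, ?_⟩
  · rw [hA, Matrix.add_apply]
    have : ∀ x, W x w = 0 := by
      intro x; simp [W, hs, hw]
    simp [mul_apply, this]
  · have h1 : 1 - N' = (1 - (N * W) * L') * (1 - N) := by
      rw [hcut, ← hK, Matrix.sub_mul 1 (N * W * L'), Matrix.one_mul]
      simp only [Matrix.mul_assoc]
      abel
    have h2 : L' * (N * W) = L' * W - U * W := by
      rw [← hK]
      simp only [Matrix.mul_sub, Matrix.sub_mul, Matrix.mul_one, Matrix.mul_assoc]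
      abel
    rw [h1, det_mul, hdet, mul_one, det_one_sub_mul_comm, h2, hL'W, hUW, hA]
    congr 1
    rw [show (2 : Matrix V V ℝ) = 1 + 1 from one_add_one_eq_two.symm]
    abel

theorem det_passageMatrix (σ s : Equiv.Perm (V × Bool)) (xs : V → List (V × Bool))
    (ρ : V → V) (χ : V → Prop) [DecidablePred χ]
    (hs : ∀ x, s x = if χ x.1 then (x.1, !x.2) else x)
    (hρ : ∀ v, ρ (ρ v) = ρ v) (hσ : ∀ x, ρ (σ x).1 = ρ x.1)
    (hxs : ∀ v, ∀ x ∈ xs v, ρ x.1 = ρ v)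
    (htel : ∀ v, ∀ f : V × Bool → ℝ,
      ((xs v).map fun x => f x - f (σ x)).sum = f (v, false) - f (v, true))
    (hreach : ∀ x, ∃ n : ℕ, (σ ^ n) x = (ρ x.1, true))
    (I : Matrix {v // χ v} {v // χ v} ℝ)
    (hI : I = (passageMatrix σ s xs).submatrix Subtype.val Subtype.val) (hskew : Iᵀ = -I) :
    (passageMatrix σ s xs).det = I.det ∧
      I.det = (1 - cutMatrix (s * σ) (fun x => x = (ρ x.1, true))).det := by
  obtain ⟨h1, h2⟩ := det_one_sub_cutMatrix_mul σ s xs ρ χ hs hρ hσ hxs htel hreach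
  refine ⟨hI ▸ det_eq_det_submatrix_of_trivial_columns χ _ h1, ?_⟩
  rw [h2, det_eq_det_submatrix_of_trivial_columns χ, ← det_transpose, hskew, hI]
  · congr 1
    ext i j
    have : (2 : Matrix V V ℝ) i.1 j.1 = (diagonal (fun v => if χ v then 2 else 0)) i.1 j.1 := by
      rw [← diagonal_ofNat, diagonal_apply, diagonal_apply, if_pos i.2]
    rw [Matrix.neg_apply, submatrix_apply, submatrix_apply, Matrix.sub_apply, Matrix.sub_apply, this]
    ring
  · intro v w hw
    rw [Matrix.sub_apply, Matrix.sub_apply, h1 v w hw, ← diagonal_ofNat, diagonal_apply, diagonal_apply,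
      Matrix.one_apply]
    by_cases hvw : v = w
    · subst hvw; simp [hw]; norm_num
    · simp [hvw]

end LinearAlgebra

namespace HalfEdgeGraph

variable {V H : Type*} {F : HalfEdgeGraph V H}

theorem tail_eq_of_cycle_eq {a : H} {t t' : List H} (hn : (a :: t).Nodup)
    (h : ((a :: t : List H) : Cycle H) = (a :: t' : List H)) : t = t' := by
  rw [Cycle.coe_eq_coe] at h
  obtain ⟨n, hn', h⟩ := List.isRotated_iff_mod.1 h
  rw [List.rotate_eq_drop_append_take hn'] at h
  have h0 := List.take_append_drop n (a :: t)
  generalize List.take n (a :: t) = x at *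
  generalize List.drop n (a :: t) = y at *
  cases x with
  | nil => simp at h h0; rw [h0] at h; simpa using h
  | cons b x =>
    cases y with
    | nil => simp at h h0; rw [h0.2] at h; exact h.2
    | cons c y =>
      simp at h h0
      rw [← h0.2] at hn
      simp [h.1] at hn

theorem exists_cons_of_mem {a : H} {c : Cycle H} (h : a ∈ c) :
    ∃ t : List H, ((a :: t : List H) : Cycle H) = c := by
  induction c using Cycle.induction_on with
  | nil => simp at h
  | cons b l _ =>
    rw [Cycle.mem_coe_iff] at h
    obtain ⟨s, t, hst⟩ := List.append_of_mem h
    refine ⟨t ++ s, ?_⟩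
    rw [hst, Cycle.coe_eq_coe]
    exact List.isRotated_append (l := a :: t) (l' := s)

theorem IsCircuit.nodup {c : Cycle H} (hc : F.IsCircuit c) : c.Nodup := by
  have := hc.2.2
  induction c using Cycle.induction_on with
  | nil => simp
  | cons b l _ =>
    rw [Cycle.map_coe, Cycle.nodup_coe_iff] at this
    exact Cycle.nodup_coe_iff.2 (List.Nodup.of_map _ this)

theorem edge_flip (h : H) : F.edge (F.flip h) = F.edge h := by
  simp [edge, F.flip_flip, Sym2.eq_swap]

theorem IsCircuit.flip_notMem {c : Cycle H} (hc : F.IsCircuit c) {h : H} (hh : h ∈ c) :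
    F.flip h ∉ c := by
  have := hc.2.2
  induction c using Cycle.induction_on with
  | nil => simp
  | cons b l _ =>
    intro h2
    rw [Cycle.map_coe, Cycle.nodup_coe_iff] at this
    rw [Cycle.mem_coe_iff] at hh h2
    exact F.flip_ne h (List.inj_on_of_nodup_map this h2 hh (edge_flip h))

theorem passage_iff {C : Set (Cycle H)} {a b : H} :
    F.Passage C a b ↔ ∃ t : List H, ((b :: t : List H) : Cycle H) ∈ C ∧
      (b :: t).getLast? = some (F.flip a) := by
  constructor
  · rintro ⟨l, hl, hb⟩
    cases l with
    | nil => exact ⟨[], by simp_all⟩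
    | cons b' l =>
      simp at hb
      subst hb
      refine ⟨l ++ [F.flip a], ?_, by rw [← List.cons_append, List.getLast?_concat]⟩
      rwa [show (b' :: (l ++ [F.flip a])) = (b' :: l) ++ [F.flip a] from rfl,
        ← Cycle.coe_cons_eq_coe_append]
  · rintro ⟨t, ht, hl⟩
    obtain ⟨ys, hys⟩ := List.getLast?_eq_some_iff.1 hl
    refine ⟨ys, ?_, by rw [← hys]; rfl⟩
    rw [Cycle.coe_cons_eq_coe_append, ← hys]
    exact ht

theorem Passage.enters {C : Set (Cycle H)} {a b : H} (h : F.Passage C a b) : F.Enters C a := by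
  obtain ⟨l, hl, -⟩ := h
  exact ⟨_, hl, by simp⟩

theorem Passage.leaves {C : Set (Cycle H)} {a b : H} (h : F.Passage C a b) : F.Leaves C b := by
  obtain ⟨l, hl, -⟩ := passage_iff.1 h
  exact ⟨_, hl, by simp⟩

theorem enters_flip {C : Set (Cycle H)} {h : H} : F.Enters C (F.flip h) ↔ F.Leaves C h := by
  simp [Enters, Leaves, F.flip_flip]

theorem exists_passage_of_enters {C : Set (Cycle H)} {a : H} (h : F.Enters C a) :
    ∃ b, F.Passage C a b := by
  obtain ⟨c, hc, ha⟩ := h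
  obtain ⟨t, rfl⟩ := exists_cons_of_mem ha
  cases t with
  | nil => exact ⟨F.flip a, [], hc, by simp⟩
  | cons b t => exact ⟨b, _, hc, by simp⟩

theorem exists_passage_of_leaves {C : Set (Cycle H)} {b : H} (h : F.Leaves C b) :
    ∃ a, F.Passage C a b := by
  obtain ⟨c, hc, hb⟩ := h
  obtain ⟨t, rfl⟩ := exists_cons_of_mem hb
  exact ⟨F.flip ((b :: t).getLast (by simp)), passage_iff.2 ⟨t, hc, by
    rw [F.flip_flip, List.getLast?_eq_getLast_of_ne_nil]⟩⟩

theorem Passage.inc_eq {C : Set (Cycle H)} (hC : ∀ c ∈ C, F.IsCircuit c) {a b : H}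
    (h : F.Passage C a b) : F.inc a = F.inc b := by
  obtain ⟨l, hl, hb⟩ := h
  have := (hC _ hl).2.1
  rw [Cycle.chain_coe_cons] at this
  cases l with
  | nil => simp at hb this; subst hb; simpa [F.flip_flip] using this
  | cons b' l => simp at hb this; subst hb; simpa [F.flip_flip] using this.1

theorem IsEulerSystem.isCircuitPartition {C : Set (Cycle H)} (hC : F.IsEulerSystem C) :
    F.IsCircuitPartition C := by
  refine ⟨fun c hc => (hC.1 c hc).choose_spec.1, fun h => ?_⟩
  obtain ⟨c, ⟨hc, hE⟩, hu⟩ := hC.2 (F.inc h)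
  refine ⟨c, ⟨hc, (hE.2 h).2 (.refl _)⟩, fun c' ⟨hc', ht⟩ => hu c' ⟨hc', ?_⟩⟩
  exact (hC.1 c' hc').choose_spec.change ht

theorem chain_passage {P : Set (Cycle H)} {c : Cycle H} (hc : c ∈ P) :
    c.Chain (fun h k => F.Passage P (F.flip h) k) := by
  induction c using Cycle.induction_on with
  | nil => simp
  | cons b l _ =>
    rw [Cycle.chain_coe_cons, List.isChain_iff_forall_rel_of_append_cons_cons]
    intro x y l₁ l₂ h
    cases l₁ with
    | nil =>
      simp at h
      obtain ⟨rfl, h⟩ := h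
      exact ⟨l, by rwa [F.flip_flip], by rw [F.flip_flip, h]; rfl⟩
    | cons b' l₁ =>
      simp at h
      obtain ⟨rfl, h⟩ := h
      refine ⟨y :: (l₂ ++ l₁), ?_, by simp⟩
      rw [Cycle.coe_cons_eq_coe_append, h] at hc
      rw [F.flip_flip]
      convert hc using 1
      rw [Cycle.coe_eq_coe]
      exact List.isRotated_append (l := x :: y :: l₂) (l' := l₁)

namespace IsCircuitPartition

variable {P : Set (Cycle H)}

theorem eq_of_traverses (hP : F.IsCircuitPartition P) {c c' : Cycle H} (hc : c ∈ P) (hc' : c' ∈ P)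
    {h : H} (h1 : F.Traverses c h) (h2 : F.Traverses c' h) : c = c' :=
  (hP.2 h).unique ⟨hc, h1⟩ ⟨hc', h2⟩

theorem leaves_or_enters (hP : F.IsCircuitPartition P) (h : H) : F.Leaves P h ∨ F.Enters P h := by
  obtain ⟨c, ⟨hc, ht⟩, -⟩ := hP.2 h
  exact ht.imp (fun h => ⟨c, hc, h⟩) (fun h => ⟨c, hc, h⟩)

theorem not_enters_of_leaves (hP : F.IsCircuitPartition P) {h : H} (h1 : F.Leaves P h) :
    ¬ F.Enters P h := by
  rintro ⟨c', hc', h'⟩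
  obtain ⟨c, hc, hh⟩ := h1
  obtain rfl := hP.eq_of_traverses hc hc' (h := h) (Or.inl hh) (Or.inr h')
  exact (hP.1 c hc).flip_notMem hh h'

theorem passage_right_unique (hP : F.IsCircuitPartition P) {a b b' : H} (h : F.Passage P a b)
    (h' : F.Passage P a b') : b = b' := by
  obtain ⟨l, hl, hb⟩ := h
  obtain ⟨l', hl', hb'⟩ := h'
  have e := hP.eq_of_traverses hl hl' (h := a) (Or.inr (by simp)) (Or.inr (by simp))
  obtain rfl := tail_eq_of_cycle_eq (Cycle.nodup_coe_iff.1 (hP.1 _ hl).nodup) e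
  rw [hb] at hb'
  exact Option.some_inj.1 hb'

theorem passage_left_unique (hP : F.IsCircuitPartition P) {a a' b : H} (h : F.Passage P a b)
    (h' : F.Passage P a' b) : a = a' := by
  obtain ⟨l, hl, hb⟩ := passage_iff.1 h
  obtain ⟨l', hl', hb'⟩ := passage_iff.1 h'
  have e := hP.eq_of_traverses hl hl' (h := b) (Or.inl (by simp)) (Or.inl (by simp))
  obtain rfl := tail_eq_of_cycle_eq (Cycle.nodup_coe_iff.1 (hP.1 _ hl).nodup) e
  rw [hb] at hb'
  have := congrArg F.flip (Option.some_inj.1 hb')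
  rwa [F.flip_flip, F.flip_flip] at this

end IsCircuitPartition

/-- `{a, b}` is a single transition of `P`. -/
def Mate (F : HalfEdgeGraph V H) (P : Set (Cycle H)) (a b : H) : Prop :=
  F.Passage P a b ∨ F.Passage P b a

theorem Mate.symm {P : Set (Cycle H)} {a b : H} (h : F.Mate P a b) : F.Mate P b a := Or.symm h

namespace IsCircuitPartition

variable {P : Set (Cycle H)}

theorem inc_eq_of_mate (hP : F.IsCircuitPartition P) {a b : H} (h : F.Mate P a b) :
    F.inc a = F.inc b :=
  h.elim (fun h => h.inc_eq hP.1) (fun h => (h.inc_eq hP.1).symm)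

theorem mate_unique (hP : F.IsCircuitPartition P) {a b b' : H} (h : F.Mate P a b)
    (h' : F.Mate P a b') : b = b' := by
  rcases h with h | h <;> rcases h' with h' | h'
  · exact hP.passage_right_unique h h'
  · exact absurd h.enters (hP.not_enters_of_leaves h'.leaves)
  · exact absurd h'.enters (hP.not_enters_of_leaves h.leaves)
  · exact hP.passage_left_unique h h'

theorem mate_ne (hP : F.IsCircuitPartition P) {a b : H} (h : F.Mate P a b) : b ≠ a := by
  rintro rfl
  rcases h with h | h <;> exact absurd h.enters (hP.not_enters_of_leaves h.leaves)

theorem exists_mate (hP : F.IsCircuitPartition P) (a : H) : ∃ b, F.Mate P a b := by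
  rcases hP.leaves_or_enters a with h | h
  · exact (exists_passage_of_leaves h).imp fun _ => Or.inr
  · exact (exists_passage_of_enters h).imp fun _ => Or.inl

theorem mem_transition_iff (hP : F.IsCircuitPartition P) {v : V} {t : Sym2 H} :
    t ∈ F.transition P v ↔ ∃ a b, F.inc a = v ∧ F.Mate P a b ∧ t = s(a, b) := by
  constructor
  · rintro ⟨a, b, ha, -, hab, rfl⟩
    exact ⟨a, b, ha, Or.inl hab, rfl⟩
  · rintro ⟨a, b, ha, hab, rfl⟩
    have hb := hP.inc_eq_of_mate hab
    rcases hab with hab | hab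
    · exact ⟨a, b, ha, hb ▸ ha, hab, rfl⟩
    · exact ⟨b, a, hb ▸ ha, ha, hab, Sym2.eq_swap⟩

theorem mk_mem_transition_iff (hP : F.IsCircuitPartition P) {v : V} {a b : H} (ha : F.inc a = v) :
    s(a, b) ∈ F.transition P v ↔ F.Mate P a b := by
  rw [hP.mem_transition_iff]
  constructor
  · rintro ⟨a', b', -, h, e⟩
    rcases Sym2.eq_iff.1 e with ⟨rfl, rfl⟩ | ⟨rfl, rfl⟩
    · exact h
    · exact h.symm
  · exact fun h => ⟨a, b, ha, h, rfl⟩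

theorem touchHalfEdge_eq (hP : F.IsCircuitPartition P) {a b : H} (h : F.Mate P a b) :
    F.touchHalfEdge P a = {s(a, b)} := by
  ext t
  simp only [touchHalfEdge, Set.mem_ofPred_eq, Set.mem_singleton_iff]
  constructor
  · rintro ⟨ht, hat⟩
    obtain ⟨b', rfl⟩ := Sym2.mem_iff_exists.1 hat
    rw [hP.mk_mem_transition_iff rfl] at ht
    rw [hP.mate_unique ht h]
  · rintro rfl
    exact ⟨(hP.mk_mem_transition_iff rfl).2 h, by simp⟩

theorem touchHalfEdge_eq_iff (hP : F.IsCircuitPartition P) {a b a' : H} (h : F.Mate P a b) :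
    F.touchHalfEdge P a' = F.touchHalfEdge P a ↔ a' = a ∨ a' = b := by
  constructor
  · obtain ⟨b', h'⟩ := hP.exists_mate a'
    rw [hP.touchHalfEdge_eq h, hP.touchHalfEdge_eq h', Set.singleton_eq_singleton_iff, Sym2.eq_iff]
    tauto
  · rintro (rfl | rfl)
    · rfl
    · rw [hP.touchHalfEdge_eq h, hP.touchHalfEdge_eq h.symm, Sym2.eq_swap]

end IsCircuitPartition

end HalfEdgeGraph

namespace HalfEdgeGraph

variable {V H : Type*} {F : HalfEdgeGraph V H} {C : Set (Cycle H)}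

namespace Signing

/-- The half-edge along which the passage `v⁺` (for `(v, true)`) or `v⁻` (for `(v, false)`)
arrives. -/
def hin (S : F.Signing C) (x : V × Bool) : H := cond x.2 (S.h₁ x.1) (S.h₃ x.1)

/-- The half-edge along which the passage `v⁺` (for `(v, true)`) or `v⁻` (for `(v, false)`)
leaves. -/
def hout (S : F.Signing C) (x : V × Bool) : H := cond x.2 (S.h₂ x.1) (S.h₄ x.1)

variable (S : F.Signing C)

theorem passage (x : V × Bool) : F.Passage C (S.hin x) (S.hout x) := by
  obtain ⟨v, b⟩ := x
  cases b
  · exact S.passage_minus v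
  · exact S.passage_plus v

theorem inc_hin (x : V × Bool) : F.inc (S.hin x) = x.1 := by
  obtain ⟨v, b⟩ := x
  cases b <;> exact (S.incident v _).2 (by simp [hin])

theorem inc_hout (x : V × Bool) : F.inc (S.hout x) = x.1 := by
  obtain ⟨v, b⟩ := x
  cases b <;> exact (S.incident v _).2 (by simp [hout])

theorem exists_eq (h : H) : ∃ x, h = S.hin x ∨ h = S.hout x := by
  rcases (S.incident (F.inc h) h).1 rfl with e | e | e | e
  · exact ⟨(F.inc h, true), Or.inl e⟩
  · exact ⟨(F.inc h, true), Or.inr e⟩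
  · exact ⟨(F.inc h, false), Or.inl e⟩
  · exact ⟨(F.inc h, false), Or.inr e⟩

theorem enters_hin (x : V × Bool) : F.Enters C (S.hin x) := (S.passage x).enters

theorem leaves_hout (x : V × Bool) : F.Leaves C (S.hout x) := (S.passage x).leaves

theorem hin_ne_hout (hC : F.IsCircuitPartition C) (x y : V × Bool) : S.hin x ≠ S.hout y :=
  fun h => hC.not_enters_of_leaves (S.leaves_hout y) (h ▸ S.enters_hin x)

theorem exists_eq_hin (hC : F.IsCircuitPartition C) {h : H} (hh : F.Enters C h) :
    ∃ x, S.hin x = h := by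
  obtain ⟨x, rfl | rfl⟩ := S.exists_eq h
  · exact ⟨x, rfl⟩
  · exact absurd hh (hC.not_enters_of_leaves (S.leaves_hout x))

theorem exists_eq_hout (hC : F.IsCircuitPartition C) {h : H} (hh : F.Leaves C h) :
    ∃ x, S.hout x = h := by
  obtain ⟨x, rfl | rfl⟩ := S.exists_eq h
  · exact absurd (S.enters_hin x) (hC.not_enters_of_leaves hh)
  · exact ⟨x, rfl⟩

theorem hin_injective (hF : F.IsFourRegular) (hC : F.IsCircuitPartition C) :
    Function.Injective S.hin := by
  have key : ∀ v, S.h₁ v ≠ S.h₃ v := by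
    intro v h
    have h' : S.h₂ v = S.h₄ v := hC.passage_right_unique (S.passage_plus v) (h ▸ S.passage_minus v)
    have : {k | F.inc k = v} = {S.h₁ v, S.h₂ v} := by
      ext k
      simp [S.incident, ← h, ← h']
      tauto
    have h4 := hF v
    rw [this] at h4
    have := Set.ncard_insert_le (S.h₁ v) {S.h₂ v}
    rw [Set.ncard_singleton] at this
    omega
  rintro ⟨v, b⟩ ⟨w, d⟩ h
  have hvw : v = w := by
    have := congrArg F.inc h
    rwa [S.inc_hin, S.inc_hin] at this
  subst hvw
  cases b <;> cases d
  · rfl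
  · exact absurd h.symm (key v)
  · exact absurd h (key v)
  · rfl

theorem hout_injective (hF : F.IsFourRegular) (hC : F.IsCircuitPartition C) :
    Function.Injective S.hout := fun x y h =>
  S.hin_injective hF hC (hC.passage_left_unique (S.passage x) (h ▸ S.passage y))

theorem exists_perm [Finite V] (hF : F.IsFourRegular) (hC : F.IsCircuitPartition C) :
    ∃ σ : Equiv.Perm (V × Bool), ∀ x, F.flip (S.hout x) = S.hin (σ x) := by
  have h : ∀ x, ∃ y, S.hin y = F.flip (S.hout x) := fun x =>
    S.exists_eq_hin hC (enters_flip.2 (S.leaves_hout x))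
  choose σ hσ using h
  have inj : Function.Injective σ := by
    intro x y hxy
    have h1 : F.flip (S.hout x) = F.flip (S.hout y) := by rw [← hσ, ← hσ, hxy]
    have := congrArg F.flip h1
    rw [F.flip_flip, F.flip_flip] at this
    exact S.hout_injective hF hC this
  exact ⟨Equiv.ofBijective σ (Finite.injective_iff_bijective.1 inj), fun x => (hσ x).symm⟩

theorem transition_eq_psi (hF : F.IsFourRegular) (hC : F.IsCircuitPartition C)
    {P : Set (Cycle H)} (hP : F.IsCircuitPartition P) {v : V}
    (h : F.Mate P (S.h₁ v) (S.h₃ v)) (h' : F.Mate P (S.h₂ v) (S.h₄ v)) :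
    F.transition P v = F.psi C v := by
  have i1 := S.inc_hin (v, true)
  have i2 := S.inc_hout (v, true)
  have i3 := S.inc_hin (v, false)
  have i4 := S.inc_hout (v, false)
  have n1 := (S.hin_injective hF hC).ne (show (v, true) ≠ (v, false) by simp)
  have n2 := (S.hout_injective hF hC).ne (show (v, true) ≠ (v, false) by simp)
  have e1 := S.enters_hin (v, true)
  have e2 := S.leaves_hout (v, true)
  have e3 := S.enters_hin (v, false)
  have e4 := S.leaves_hout (v, false)
  simp only [hin, hout, cond_true, cond_false] at i1 i2 i3 i4 n1 n2 e1 e2 e3 e4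
  ext t
  rw [hP.mem_transition_iff]
  constructor
  · rintro ⟨a, b, ha, hab, rfl⟩
    rcases (S.incident v a).1 ha with rfl | rfl | rfl | rfl
    · obtain rfl := hP.mate_unique h hab
      exact ⟨_, _, i1, i3, n1, Or.inl ⟨e1, e3⟩, rfl⟩
    · obtain rfl := hP.mate_unique h' hab
      exact ⟨_, _, i2, i4, n2, Or.inr ⟨e2, e4⟩, rfl⟩
    · obtain rfl := hP.mate_unique h.symm hab
      exact ⟨_, _, i3, i1, n1.symm, Or.inl ⟨e3, e1⟩, rfl⟩
    · obtain rfl := hP.mate_unique h'.symm hab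
      exact ⟨_, _, i4, i2, n2.symm, Or.inr ⟨e4, e2⟩, rfl⟩
  · rintro ⟨a, b, ha, hb, hab, hE, rfl⟩
    refine ⟨a, b, ha, ?_, rfl⟩
    have x1 := hC.not_enters_of_leaves e2
    have x2 := hC.not_enters_of_leaves e4
    have x3 := fun h => hC.not_enters_of_leaves h e1
    have x4 := fun h => hC.not_enters_of_leaves h e3
    rcases (S.incident v a).1 ha with rfl | rfl | rfl | rfl <;>
    rcases (S.incident v b).1 hb with rfl | rfl | rfl | rfl <;>
    first
      | exact absurd rfl hab
      | exact h
      | exact h'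
      | exact h.symm
      | exact h'.symm
      | (exfalso; tauto)

/-- A circuit partition that avoids `ψ_C(v)` pairs the half-edges at `v` like `φ_C(v)` or like
`χ_C(v)`. -/
theorem mate_cases (hF : F.IsFourRegular) (hC : F.IsCircuitPartition C)
    {P : Set (Cycle H)} (hP : F.IsCircuitPartition P) {v : V}
    (hψ : F.transition P v ≠ F.psi C v) :
    (F.Mate P (S.h₁ v) (S.h₂ v) ∧ F.Mate P (S.h₃ v) (S.h₄ v)) ∨
      (F.Mate P (S.h₁ v) (S.h₄ v) ∧ F.Mate P (S.h₃ v) (S.h₂ v)) := by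
  have n1 : S.h₁ v ≠ S.h₃ v :=
    (S.hin_injective hF hC).ne (show (v, true) ≠ (v, false) by simp)
  have n2 : S.h₂ v ≠ S.h₄ v :=
    (S.hout_injective hF hC).ne (show (v, true) ≠ (v, false) by simp)
  have n3 : S.h₁ v ≠ S.h₂ v := S.hin_ne_hout hC (v, true) (v, true)
  have n4 : S.h₁ v ≠ S.h₄ v := S.hin_ne_hout hC (v, true) (v, false)
  have n5 : S.h₃ v ≠ S.h₂ v := S.hin_ne_hout hC (v, false) (v, true)
  have n6 : S.h₃ v ≠ S.h₄ v := S.hin_ne_hout hC (v, false) (v, false)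
  have mem : ∀ {a b}, F.inc a = v → F.Mate P a b →
      b = S.h₁ v ∨ b = S.h₂ v ∨ b = S.h₃ v ∨ b = S.h₄ v := fun ha hab =>
    (S.incident v _).1 (by rw [← hP.inc_eq_of_mate hab, ha])
  obtain ⟨b, hb⟩ := hP.exists_mate (S.h₁ v)
  obtain ⟨d, hd⟩ := hP.exists_mate (S.h₃ v)
  rcases mem (S.inc_hin (v, true)) hb with rfl | rfl | rfl | rfl
  · exact absurd rfl (hP.mate_ne hb)
  · rcases mem (S.inc_hin (v, false)) hd with rfl | rfl | rfl | rfl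
    · exact absurd (hP.mate_unique hb hd.symm) n5.symm
    · exact absurd (hP.mate_unique hb.symm hd.symm) n1
    · exact absurd rfl (hP.mate_ne hd)
    · exact Or.inl ⟨hb, hd⟩
  · obtain ⟨e, he⟩ := hP.exists_mate (S.h₂ v)
    rcases mem (S.inc_hout (v, true)) he with rfl | rfl | rfl | rfl
    · exact absurd (hP.mate_unique hb he.symm) n5
    · exact absurd rfl (hP.mate_ne he)
    · exact absurd (hP.mate_unique hb.symm he.symm) n3
    · exact absurd (S.transition_eq_psi hF hC hP hb he) hψ
  · rcases mem (S.inc_hin (v, false)) hd with rfl | rfl | rfl | rfl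
    · exact absurd (hP.mate_unique hb hd.symm) n6.symm
    · exact Or.inr ⟨hb, hd⟩
    · exact absurd rfl (hP.mate_ne hd)
    · exact absurd (hP.mate_unique hb.symm hd.symm) n1

theorem transition_eq_chi_iff (hF : F.IsFourRegular) (hC : F.IsCircuitPartition C)
    {P : Set (Cycle H)} (hP : F.IsCircuitPartition P) {v : V}
    (hψ : F.transition P v ≠ F.psi C v) :
    F.transition P v = F.chi C v ↔ F.Mate P (S.h₁ v) (S.h₄ v) := by
  have i1 : F.inc (S.h₁ v) = v := S.inc_hin (v, true)
  have i2 : F.inc (S.h₂ v) = v := S.inc_hout (v, true)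
  have i3 : F.inc (S.h₃ v) = v := S.inc_hin (v, false)
  have i4 : F.inc (S.h₄ v) = v := S.inc_hout (v, false)
  have n2 : S.h₂ v ≠ S.h₄ v :=
    (S.hout_injective hF hC).ne (show (v, true) ≠ (v, false) by simp)
  have e1 : F.Enters C (S.h₁ v) := S.enters_hin (v, true)
  have e2 : F.Leaves C (S.h₂ v) := S.leaves_hout (v, true)
  have e3 : F.Enters C (S.h₃ v) := S.enters_hin (v, false)
  have e4 : F.Leaves C (S.h₄ v) := S.leaves_hout (v, false)
  have p14 : ¬ F.Passage C (S.h₁ v) (S.h₄ v) := fun h =>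
    n2 (hC.passage_right_unique (S.passage_plus v) h)
  have p32 : ¬ F.Passage C (S.h₃ v) (S.h₂ v) := fun h =>
    n2 (hC.passage_right_unique h (S.passage_minus v))
  constructor
  · intro h
    rw [← hP.mk_mem_transition_iff i1, h]
    exact ⟨_, _, i1, i4, e1, e4, p14, rfl⟩
  · intro h
    have h' : F.Mate P (S.h₃ v) (S.h₂ v) := by
      rcases S.mate_cases hF hC hP hψ with ⟨h', -⟩ | ⟨-, h'⟩
      · exact absurd (hP.mate_unique h' h) n2
      · exact h'
    ext t
    rw [hP.mem_transition_iff]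
    constructor
    · rintro ⟨a, b, ha, hab, rfl⟩
      rcases (S.incident v a).1 ha with rfl | rfl | rfl | rfl
      · obtain rfl := hP.mate_unique h hab
        exact ⟨_, _, i1, i4, e1, e4, p14, rfl⟩
      · obtain rfl := hP.mate_unique h'.symm hab
        exact ⟨_, _, i3, i2, e3, e2, p32, Sym2.eq_swap⟩
      · obtain rfl := hP.mate_unique h' hab
        exact ⟨_, _, i3, i2, e3, e2, p32, rfl⟩
      · obtain rfl := hP.mate_unique h.symm hab
        exact ⟨_, _, i1, i4, e1, e4, p14, Sym2.eq_swap⟩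
    · rintro ⟨a, b, ha, hb, hE, hL, hn, rfl⟩
      refine ⟨a, b, ha, ?_, rfl⟩
      obtain ⟨x, rfl⟩ := S.exists_eq_hin hC hE
      obtain ⟨y, rfl⟩ := S.exists_eq_hout hC hL
      rw [S.inc_hin] at ha
      rw [S.inc_hout] at hb
      obtain ⟨u, b⟩ := x
      obtain ⟨w, d⟩ := y
      subst ha hb
      cases b <;> cases d
      · exact absurd (S.passage _) hn
      · exact h'
      · exact h
      · exact absurd (S.passage _) hn

/-- The single transitions of `P` are described by a permutation of the passages of `C` which
exchanges the two passages at `v` when `P(v) = χ_C(v)`. -/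
theorem exists_swap (hF : F.IsFourRegular) (hC : F.IsCircuitPartition C)
    {P : Set (Cycle H)} (hP : F.IsCircuitPartition P)
    (hψ : ∀ v, F.transition P v ≠ F.psi C v)
    [DecidablePred fun v => F.transition P v = F.chi C v] :
    ∃ s : Equiv.Perm (V × Bool),
      (∀ x, s x = if F.transition P x.1 = F.chi C x.1 then (x.1, !x.2) else x) ∧
      ∀ x, F.Mate P (S.hin x) (S.hout (s x)) := by
  let f : V × Bool → V × Bool := fun x =>
    if F.transition P x.1 = F.chi C x.1 then (x.1, !x.2) else x
  have hf : Function.Involutive f := by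
    rintro ⟨v, b⟩
    by_cases h : F.transition P v = F.chi C v <;> simp [f, h]
  refine ⟨hf.toPerm, fun x => rfl, fun x => ?_⟩
  obtain ⟨v, b⟩ := x
  change F.Mate P (S.hin (v, b)) (S.hout (if F.transition P v = F.chi C v then (v, !b) else (v, b)))
  have h1 := S.transition_eq_chi_iff hF hC hP (hψ v)
  rcases S.mate_cases hF hC hP (hψ v) with h | h
  · have : ¬ F.Mate P (S.h₁ v) (S.h₄ v) := fun h' =>
      (S.hout_injective hF hC).ne (show (v, true) ≠ (v, false) by simp) (hP.mate_unique h.1 h')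
    rw [if_neg (h1.not.2 this)]
    cases b
    · exact h.2
    · exact h.1
  · rw [if_pos (h1.2 h.1)]
    cases b
    · exact h.2
    · exact h.1

end Signing

theorem Connected.flip (h : H) : F.Connected (F.inc h) (F.inc (F.flip h)) :=
  .rel _ _ ⟨h, rfl, rfl⟩

theorem connected_equivalence : Equivalence F.Connected :=
  Relation.EqvGen.is_equivalence _

namespace Signing

variable (S : F.Signing C)

theorem connected_step {σ s : Equiv.Perm (V × Bool)}
    (hσ : ∀ x, F.flip (S.hout x) = S.hin (σ x)) (hs : ∀ x, (s x).1 = x.1) (x : V × Bool) :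
    F.Connected x.1 ((s * σ) x).1 := by
  have := Connected.flip (F := F) (S.hout x)
  rw [hσ, S.inc_hout, S.inc_hin] at this
  rwa [Equiv.Perm.mul_apply, hs]

theorem connected_of_sameCycle [Finite V] {σ s : Equiv.Perm (V × Bool)}
    (hσ : ∀ x, F.flip (S.hout x) = S.hin (σ x)) (hs : ∀ x, (s x).1 = x.1) {x y : V × Bool}
    (h : (s * σ).SameCycle x y) : F.Connected x.1 y.1 := by
  obtain ⟨n, -, rfl⟩ := h.exists_pow_eq'
  induction n with
  | zero => exact .refl _
  | succ n ih =>
    rw [pow_succ', Equiv.Perm.mul_apply]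
    exact .trans _ _ _ (ih (Equiv.Perm.sameCycle_pow_right.2 (.refl _ _))) (S.connected_step hσ hs _)

theorem traverses_flip {c : Cycle H} {h : H} : F.Traverses c (F.flip h) ↔ F.Traverses c h := by
  simp [Traverses, F.flip_flip, or_comm]

theorem _root_.HalfEdgeGraph.Mate.exists_traverses {P : Set (Cycle H)} {a b : H}
    (h : F.Mate P a b) : ∃ c ∈ P, F.Traverses c a ∧ F.Traverses c b := by
  have key : ∀ {a b}, F.Passage P a b → ∃ c ∈ P, F.Traverses c a ∧ F.Traverses c b := by
    rintro a b ⟨l, hl, hb⟩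
    refine ⟨_, hl, Or.inr (by simp), Or.inl ?_⟩
    cases l with
    | nil => simp at hb; simp [hb]
    | cons b' l => simp at hb; simp [hb]
  rcases h with h | h
  · exact key h
  · obtain ⟨c, hc, h1, h2⟩ := key h
    exact ⟨c, hc, h2, h1⟩

theorem exists_edge_index [Finite V] (hF : F.IsFourRegular) (hC : F.IsCircuitPartition C)
    (σ : Equiv.Perm (V × Bool)) :
    ∃ idx : H → V × Bool, (∀ x, idx (S.hout x) = x) ∧ ∀ x, idx (S.hin x) = σ⁻¹ x := by
  have : ∀ h, ∃ x, ∀ y, (h = S.hout y → x = y) ∧ (h = S.hin y → x = σ⁻¹ y) := by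
    intro h
    obtain ⟨x, rfl | rfl⟩ := S.exists_eq h
    · refine ⟨σ⁻¹ x, fun y => ⟨fun e => absurd e (S.hin_ne_hout hC _ _), fun e => ?_⟩⟩
      rw [S.hin_injective hF hC e]
    · exact ⟨x, fun y => ⟨fun e => S.hout_injective hF hC e,
        fun e => absurd e.symm (S.hin_ne_hout hC _ _)⟩⟩
  choose idx h using this
  exact ⟨idx, fun x => (h _ x).1 rfl, fun x => (h _ x).2 rfl⟩

/-- Two edges are traversed by the same circuit of `P` when they are in the same cycle of the
permutation that follows `P`. -/
theorem traverses_iff_sameCycle [Finite V] (hF : F.IsFourRegular) (hC : F.IsCircuitPartition C)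
    {P : Set (Cycle H)} (hP : F.IsCircuitPartition P)
    {σ s : Equiv.Perm (V × Bool)} (hσ : ∀ x, F.flip (S.hout x) = S.hin (σ x))
    (hm : ∀ x, F.Mate P (S.hin x) (S.hout (s x))) {c : Cycle H} (hc : c ∈ P) {x y : V × Bool}
    (hx : F.Traverses c (S.hout x)) :
    F.Traverses c (S.hout y) ↔ (s * σ).SameCycle x y := by
  constructor
  · intro hy
    obtain ⟨idx, hidx, hidx'⟩ := S.exists_edge_index hF hC σ
    have step : ∀ h k, F.Passage P (F.flip h) k → (s * σ).SameCycle (idx h) (idx k) := by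
      intro h k hp
      obtain ⟨z, hz | hz⟩ := S.exists_eq (F.flip h)
      · have h1 : h = S.hout (σ⁻¹ z) := by
          rw [← F.flip_flip (S.hout (σ⁻¹ z)), hσ, Equiv.Perm.coe_inv, Equiv.apply_symm_apply, ← hz, F.flip_flip]
        have h2 : k = S.hout (s z) := hP.mate_unique (Or.inl hp) (hz ▸ hm z)
        rw [h1, h2, hidx, hidx]
        exact ⟨1, by simp⟩
      · have h1 : h = S.hin (σ z) := by rw [← hσ, ← hz, F.flip_flip]
        have h2 : k = S.hin (s⁻¹ z) := by
          have := hm (s⁻¹ z)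
          rw [Equiv.Perm.coe_inv, Equiv.apply_symm_apply, ← hz] at this
          exact hP.mate_unique (Or.inl hp) this.symm
        rw [h1, h2, hidx', hidx']
        exact ⟨-1, by simp⟩
    have tr : IsTrans H (fun h k => (s * σ).SameCycle (idx h) (idx k)) := ⟨fun _ _ _ => .trans⟩
    have all := Cycle.chain_iff_pairwise.1 ((chain_passage hc).imp step)
    have key : ∀ z, F.Traverses c (S.hout z) → ∃ h ∈ c, idx h = z := by
      rintro z (h | h)
      · exact ⟨_, h, hidx z⟩
      · exact ⟨_, h, by rw [hσ, hidx']; simp⟩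
    obtain ⟨h, hh, rfl⟩ := key x hx
    obtain ⟨k, hk, rfl⟩ := key y hy
    exact all h hh k hk
  · intro h
    obtain ⟨n, -, rfl⟩ := h.exists_pow_eq'
    clear h
    induction n with
    | zero => exact hx
    | succ n ih =>
      rw [pow_succ', Equiv.Perm.mul_apply]
      obtain ⟨c', hc', h1, h2⟩ := (hm (σ (((s * σ) ^ n) x))).exists_traverses
      rw [← hσ, traverses_flip] at h1
      obtain rfl := hP.eq_of_traverses hc hc' ih h1
      exact h2

theorem isEulerSystem_iff [Finite V] (hF : F.IsFourRegular) (hC : F.IsCircuitPartition C)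
    {P : Set (Cycle H)} (hP : F.IsCircuitPartition P)
    {σ s : Equiv.Perm (V × Bool)} (hσ : ∀ x, F.flip (S.hout x) = S.hin (σ x))
    (hs : ∀ x, (s x).1 = x.1) (hm : ∀ x, F.Mate P (S.hin x) (S.hout (s x))) :
    F.IsEulerSystem P ↔
      ∀ x y : V × Bool, F.Connected x.1 y.1 → (s * σ).SameCycle x y := by
  constructor
  · intro hE x y hxy
    obtain ⟨c, ⟨hc, hEc⟩, -⟩ := hE.2 x.1
    refine (S.traverses_iff_sameCycle hF hC hP hσ hm hc ?_).1 ?_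
    · exact (hEc.2 _).2 (by rw [S.inc_hout]; exact .refl _)
    · exact (hEc.2 _).2 (by rw [S.inc_hout]; exact hxy)
  · intro h
    have red : ∀ k, ∃ x, (∀ c, F.Traverses c k ↔ F.Traverses c (S.hout x)) ∧
        F.Connected (F.inc k) x.1 := by
      intro k
      obtain ⟨x, rfl | rfl⟩ := S.exists_eq k
      · have e : S.hin x = F.flip (S.hout (σ⁻¹ x)) := by rw [hσ, Equiv.Perm.coe_inv, Equiv.apply_symm_apply]
        refine ⟨σ⁻¹ x, fun c => by rw [e, traverses_flip], ?_⟩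
        have := Connected.flip (F := F) (S.hout (σ⁻¹ x))
        rw [S.inc_hout, ← e] at this
        exact .symm _ _ this
      · exact ⟨x, fun c => Iff.rfl, by rw [S.inc_hout]; exact .refl _⟩
    have euler : ∀ c ∈ P, ∀ k, F.Traverses c k → F.IsEulerCircuitAt (F.inc k) c := by
      intro c hc k hk
      refine ⟨hP.1 c hc, fun k' => ?_⟩
      obtain ⟨x, hx, hkx⟩ := red k
      obtain ⟨y, hy, hky⟩ := red k'
      rw [hy, S.traverses_iff_sameCycle hF hC hP hσ hm hc ((hx c).1 hk)]
      constructor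
      · intro h'
        exact .trans _ _ _ hkx (.trans _ _ _ (S.connected_of_sameCycle hσ hs h') (.symm _ _ hky))
      · intro h'
        exact h _ _ (.trans _ _ _ (.symm _ _ hkx) (.trans _ _ _ h' hky))
    refine ⟨fun c hc => ?_, fun v => ?_⟩
    · have hne := (hP.1 c hc).1
      induction c using Cycle.induction_on with
      | nil => exact absurd rfl hne
      | cons b l _ => exact ⟨_, euler _ hc b (Or.inl (by simp))⟩
    · obtain ⟨c, ⟨hc, ht⟩, hu⟩ := hP.2 (S.hout (v, true))
      refine ⟨c, ⟨hc, ?_⟩, fun c' ⟨hc', hE⟩ => hu c' ⟨hc', (hE.2 _).2 ?_⟩⟩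
      · simpa [S.inc_hout] using euler c hc _ ht
      · rw [S.inc_hout]; exact .refl _

end Signing

end HalfEdgeGraph

theorem List.sum_map_sub_of_isChain {X : Type*} (σ : X → X) (f : X → ℝ) {l : List X} {a z : X}
    (hl : l.IsChain fun x y => σ x = y) (ha : l.head? = some a) (hz : l.getLast? = some z) :
    (l.map fun x => f x - f (σ x)).sum = f a - f (σ z) := by
  induction l generalizing a with
  | nil => simp at ha
  | cons b l ih =>
    simp at ha
    subst ha
    cases l with
    | nil => simp at hz; simp [hz]
    | cons c l =>
      rw [List.isChain_cons_cons] at hl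
      rw [List.map_cons, List.sum_cons, ih hl.2 rfl (by simpa using hz), hl.1]
      ring

namespace HalfEdgeGraph

variable {V H : Type*} {F : HalfEdgeGraph V H} {C : Set (Cycle H)}

theorem walkVector_touchWalk [DecidableEq (Set (Sym2 H))] (P : Set (Cycle H))
    (init : V → Set (Sym2 H)) (l : List H) (w : V) :
    walkVector init (F.touchWalk P l) w = (l.map fun e =>
      ((if F.touchHalfEdge P (F.flip e) = init w then 1 else 0) -
        (if F.touchHalfEdge P e = init w then 1 else 0) : ℝ)).sum := by
  have h1 : ∀ (i : Set (Sym2 H)) (W : List (Set (Sym2 H) × Set (Sym2 H))),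
      ((W.filter fun q => q.1 ≠ q.2).countP (fun q => q.1 = i) : ℝ) -
        ((W.filter fun q => q.1 ≠ q.2).countP (fun q => q.2 = i) : ℝ) =
      (W.map fun q => ((if q.1 = i then 1 else 0) - (if q.2 = i then 1 else 0) : ℝ)).sum := by
    intro i W
    induction W with
    | nil => simp
    | cons q W ih =>
      rw [List.map_cons, List.sum_cons, ← ih]
      by_cases h : q.1 = q.2
      · rw [List.filter_cons_of_neg (by simpa using h), h]
        ring
      · rw [List.filter_cons_of_pos (by simpa using h), List.countP_cons, List.countP_cons]
        simp only [decide_eq_true_eq]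
        push_cast
        ring
  have h2 : ∀ (f g : H → ℝ) (l l' : List H), l.length = l'.length →
      ((l.zip l').map fun p => f p.1 - g p.2).sum = (l.map f).sum - (l'.map g).sum := by
    intro f g l
    induction l with
    | nil => intro l' h; rw [List.eq_nil_of_length_eq_zero h.symm]; simp
    | cons a l ih =>
      intro l' h
      cases l' with
      | nil => simp at h
      | cons b l' =>
        simp only [List.zip_cons_cons, List.map_cons, List.sum_cons]
        rw [ih l' (by simpa using h)]
        ring
  have h3 := h1 (init w) ((l.zip (l.rotate 1)).map
    (fun p => (F.touchHalfEdge P (F.flip p.1), F.touchHalfEdge P p.2)))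
  have h4 : ∀ (f g : H → ℝ) (l : List H),
      (l.map fun e => f e - g e).sum = (l.map f).sum - (l.map g).sum := by
    intro f g l
    induction l with
    | nil => simp
    | cons a l ih => simp only [List.map_cons, List.sum_cons, ih]; ring
  have h5 := ((List.rotate_perm l 1).map
    (fun e => if F.touchHalfEdge P e = init w then (1 : ℝ) else 0)).sum_eq
  rw [h4, ← h5, ← h2 _ _ _ _ (by simp)]
  rw [List.map_map] at h3
  convert h3 using 1
  · unfold walkVector touchWalk
    congr!
  · rfl

namespace Signing

variable (S : F.Signing C)

theorem stdMatrix_eq [Finite V] [DecidableEq V] (hF : F.IsFourRegular) (hC : F.IsEulerSystem C)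
    {P : Set (Cycle H)} (hP : F.IsCircuitPartition P)
    {σ s : Equiv.Perm (V × Bool)} (hσ : ∀ x, F.flip (S.hout x) = S.hin (σ x))
    (hm : ∀ x, F.Mate P (S.hin x) (S.hout (s x))) {xs : V → List (V × Bool)}
    (hxs : ∀ v, S.fundamental hC v = (xs v).map S.hout) :
    S.stdMatrix hC P = passageMatrix σ s xs := by
  classical
  have hC' := hC.isCircuitPartition
  ext v w
  rw [stdMatrix, Matrix.of_apply, walkVector_touchWalk, hxs, List.map_map, passageMatrix,
    Matrix.of_apply]
  congr 1
  refine List.map_congr_left fun x _ => ?_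
  have e : S.h₁ w = S.hin (w, true) := rfl
  have h1 : F.touchHalfEdge P (S.hin (σ x)) = F.touchHalfEdge P (S.hin (w, true)) ↔
      σ x = (w, true) := by
    rw [hP.touchHalfEdge_eq_iff (hm _), (S.hin_injective hF hC').eq_iff]
    simp [S.hin_ne_hout hC']
  have h2 : F.touchHalfEdge P (S.hout x) = F.touchHalfEdge P (S.hin (w, true)) ↔
      x = s (w, true) := by
    rw [hP.touchHalfEdge_eq_iff (hm _), (S.hout_injective hF hC').eq_iff]
    simp [(S.hin_ne_hout hC' _ _).symm]
  simp only [Function.comp_apply, e, hσ, h1, h2]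

theorem exists_fundamental_walk [Finite V] (hF : F.IsFourRegular) (hC : F.IsEulerSystem C)
    {σ : Equiv.Perm (V × Bool)} (hσ : ∀ x, F.flip (S.hout x) = S.hin (σ x)) (v : V) :
    ∃ (xs : List (V × Bool)) (z : V × Bool) (m : List H),
      S.fundamental hC v = xs.map S.hout ∧ xs.Nodup ∧ xs.IsChain (fun x y => σ x = y) ∧
      xs.head? = some (v, false) ∧ xs.getLast? = some z ∧ σ z = (v, true) ∧
      ((xs.map S.hout ++ S.h₂ v :: m : List H) : Cycle H) ∈ C := by
  have hC' := hC.isCircuitPartition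
  obtain ⟨⟨m, hm⟩, hhead, hlast⟩ := (S.exists_isFundamental hC v).choose_spec
  change ((S.fundamental hC v ++ m : List H) : Cycle H) ∈ C at hm
  change (S.fundamental hC v).head? = _ at hhead
  change (S.fundamental hC v).getLast? = _ at hlast
  generalize S.fundamental hC v = l at *
  obtain ⟨idx, hidx, -⟩ := S.exists_edge_index hF hC' σ
  have hl : l = (l.map idx).map S.hout := by
    rw [List.map_map]
    conv_lhs => rw [← List.map_id l]
    refine List.map_congr_left fun e he => ?_
    obtain ⟨x, rfl⟩ := S.exists_eq_hout hC' (h := e) ⟨_, hm, by simp [he]⟩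
    simp [hidx]
  generalize l.map idx = xs at hl
  subst hl
  have hnd := Cycle.nodup_coe_iff.1 (hC'.1 _ hm).nodup
  have hhead' : xs.head? = some (v, false) := by
    cases xs with
    | nil => simp at hhead
    | cons x xs =>
      simp at hhead
      simp [S.hout_injective hF hC' (hhead.trans (rfl : _ = S.hout (v, false)))]
  obtain ⟨z, hz⟩ : ∃ z, xs.getLast? = some z := by
    cases h : xs.getLast? with
    | none => simp at h; simp [h] at hhead'
    | some z => exact ⟨z, rfl⟩
  have hz' : S.hout z = F.flip (S.h₁ v) := by
    rw [List.getLast?_map, hz] at hlast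
    simpa using hlast
  have hzσ : σ z = (v, true) := by
    apply S.hin_injective hF hC'
    rw [← hσ, hz', F.flip_flip]
    rfl
  have hm' : ∃ m', m = S.h₂ v :: m' := by
    obtain ⟨ys, hys⟩ := List.getLast?_eq_some_iff.1 hz
    have h1 : ((F.flip (S.h₁ v) :: (m ++ ys.map S.hout) : List H) : Cycle H) ∈ C := by
      convert hm using 1
      rw [hys, Cycle.coe_eq_coe, ← hz']
      simpa using List.isRotated_append (l := S.hout z :: m) (l' := ys.map S.hout)
    cases m with
    | cons a m =>
      have h2 : F.Passage C (S.h₁ v) a := ⟨_, h1, by simp⟩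
      exact ⟨m, by rw [hC'.passage_right_unique h2 (S.passage_plus v)]⟩
    | nil =>
      have h2 : F.Passage C (S.h₁ v) (S.h₄ v) := by
        refine ⟨_, h1, ?_⟩
        rw [← hz']
        simpa [hys] using hhead
      have := S.hout_injective hF hC' (a₁ := (v, false)) (a₂ := (v, true))
        (hC'.passage_right_unique h2 (S.passage_plus v))
      simp at this
  obtain ⟨m', rfl⟩ := hm'
  refine ⟨xs, z, m', rfl, List.Nodup.of_map _ (List.nodup_append.1 hnd).1, ?_, hhead', hz, hzσ, hm⟩
  rw [List.isChain_iff_forall_rel_of_append_cons_cons]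
  intro x y l₁ l₂ h
  have h1 : F.Passage C (S.hin (σ x)) (S.hout y) := by
    refine ⟨S.hout y :: (l₂.map S.hout ++ (S.h₂ v :: m') ++ l₁.map S.hout), ?_, by simp⟩
    convert hm using 1
    rw [h, Cycle.coe_eq_coe, ← hσ, F.flip_flip]
    simpa using List.isRotated_append
      (l := S.hout x :: S.hout y :: (l₂.map S.hout ++ (S.h₂ v :: m'))) (l' := l₁.map S.hout)
  exact S.hout_injective hF hC' (hC'.passage_right_unique (S.passage (σ x)) h1)

/-- The cyclic order `v⁺ q v⁻ p` in terms of the fundamental circuit of `v`. -/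
theorem inOrder_iff (hC : F.IsCircuitPartition C) {v : V} {l m : List H} {p q : H}
    (hl : l.head? = some (S.h₄ v)) (hm : ((l ++ S.h₂ v :: m : List H) : Cycle H) ∈ C)
    (hp : p ≠ S.h₄ v) (hq : q ≠ S.h₂ v)
    (hpq : ∀ c ∈ C, p ∈ c → q ∈ c) :
    F.InOrder C (S.h₂ v) q (S.h₄ v) p ↔ p ∈ l ∧ q ∉ l := by
  have hnd := Cycle.nodup_coe_iff.1 (hC.1 _ hm).nodup
  obtain ⟨t, rfl⟩ : ∃ t, l = S.h₄ v :: t := by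
    cases l with
    | nil => simp at hl
    | cons a t => simp at hl; exact ⟨t, by rw [hl]⟩
  constructor
  · rintro ⟨k, l', m', n, h⟩
    have h1 : ((S.h₄ v :: (m' ++ p :: n ++ S.h₂ v :: (k ++ q :: l')) : List H) : Cycle H) ∈ C := by
      convert h using 1
      rw [Cycle.coe_eq_coe]
      simpa using List.isRotated_append (l := S.h₄ v :: (m' ++ p :: n))
        (l' := S.h₂ v :: (k ++ q :: l'))
    have e := hC.eq_of_traverses hm h1 (h := S.h₄ v) (Or.inl (by simp)) (Or.inl (by simp))
    have e2 := tail_eq_of_cycle_eq (t := t ++ S.h₂ v :: m) hnd e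
    have hnd' : (t ++ S.h₂ v :: m).Nodup := (List.nodup_cons.1 hnd).2
    have hsplit : ∀ (a b c d : List H) (x : H), a ++ x :: b = c ++ x :: d → x ∉ a → x ∉ c →
        a = c ∧ b = d := by
      intro a b c d x h ha hc
      induction a generalizing c with
      | nil =>
        cases c with
        | nil => simpa using h
        | cons y c => simp at h hc; exact absurd h.1 hc.1
      | cons z a ih =>
        cases c with
        | nil => simp at h ha; exact absurd h.1.symm ha.1
        | cons y c =>
          simp at h ha hc
          obtain ⟨h1, h2⟩ := ih c h.2 ha.2 hc.2
          exact ⟨by rw [h.1, h1], h2⟩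
    have n1 : S.h₂ v ∉ t := fun h => by
      rw [List.nodup_append] at hnd'
      exact hnd'.2.2 _ h _ (by simp) rfl
    have n2 : S.h₂ v ∉ m' ++ p :: n := fun h => by
      rw [e2, List.nodup_append] at hnd'
      exact hnd'.2.2 _ h _ (by simp) rfl
    obtain ⟨rfl, rfl⟩ := hsplit _ _ _ _ _ e2 n1 n2
    refine ⟨by simp, fun h => ?_⟩
    rw [List.nodup_append] at hnd
    exact hnd.2.2 _ h _ (by simp) rfl
  · rintro ⟨hpl, hql⟩
    have hqc := hpq _ hm (by simp only [Cycle.mem_coe_iff, List.mem_append]; exact Or.inl hpl)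
    have hqm : q ∈ m := by
      simp only [Cycle.mem_coe_iff, List.mem_append, List.mem_cons] at hqc hql
      tauto
    have hpt : p ∈ t := by simpa [hp] using hpl
    obtain ⟨m', n, rfl⟩ := List.append_of_mem hpt
    obtain ⟨k, l', rfl⟩ := List.append_of_mem hqm
    refine ⟨k, l', m', n, ?_⟩
    convert hm using 1
    rw [Cycle.coe_eq_coe]
    simpa using List.isRotated_append (l := S.h₂ v :: (k ++ q :: l')) (l' := S.h₄ v :: (m' ++ p :: n))

end Signing

end HalfEdgeGraph

namespace HalfEdgeGraph

variable {V H : Type*} {F : HalfEdgeGraph V H} {C : Set (Cycle H)}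

theorem InOrder.rotate {a b c d : H} (h : F.InOrder C a b c d) : F.InOrder C d a b c := by
  obtain ⟨k, l, m, n, h⟩ := h
  refine ⟨n, k, l, m, ?_⟩
  convert h using 1
  rw [Cycle.coe_eq_coe]
  simpa using List.isRotated_append (l := d :: n) (l' := a :: k ++ b :: l ++ c :: m)

namespace Signing

variable (S : F.Signing C)

theorem interlacement_transpose {v w : V}
    (h : ¬ (F.InOrder C (S.h₂ v) (S.h₄ w) (S.h₄ v) (S.h₂ w) ∧
      F.InOrder C (S.h₂ v) (S.h₂ w) (S.h₄ v) (S.h₄ w))) :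
    S.interlacement w v = - S.interlacement v w := by
  have h1 : F.InOrder C (S.h₂ w) (S.h₄ v) (S.h₄ w) (S.h₂ v) ↔
      F.InOrder C (S.h₂ v) (S.h₂ w) (S.h₄ v) (S.h₄ w) :=
    ⟨fun h => h.rotate, fun h => h.rotate.rotate.rotate⟩
  have h2 : F.InOrder C (S.h₂ w) (S.h₂ v) (S.h₄ w) (S.h₄ v) ↔
      F.InOrder C (S.h₂ v) (S.h₄ w) (S.h₄ v) (S.h₂ w) :=
    ⟨fun h => h.rotate.rotate.rotate, fun h => h.rotate⟩
  simp only [interlacement, Matrix.of_apply, h1, h2, eq_comm (a := w)]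
  split_ifs <;> first | tauto | simp

theorem mem_circuit_of_hout (hC : F.IsEulerSystem C) {x y : V × Bool}
    (hxy : F.Connected x.1 y.1) {c : Cycle H} (hc : c ∈ C) (hx : S.hout x ∈ c) :
    S.hout y ∈ c := by
  have hC' := hC.isCircuitPartition
  have h1 := (hC.1 c hc).choose_spec.change (h := S.hout x) (Or.inl hx)
  rw [S.inc_hout] at h1
  refine ((h1.2 (S.hout y)).2 (by rwa [S.inc_hout])).resolve_right fun h => ?_
  exact hC'.not_enters_of_leaves (S.leaves_hout y) ⟨c, hc, h⟩

theorem interlacement_eq [Fintype V] [DecidableEq V] (hF : F.IsFourRegular)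
    (hC : F.IsEulerSystem C) {σ s : Equiv.Perm (V × Bool)} {xs : V → List (V × Bool)}
    {z : V → V × Bool} {m : V → List H}
    (hnd : ∀ v, (xs v).Nodup) (hchain : ∀ v, (xs v).IsChain (fun x y => σ x = y))
    (hhead : ∀ v, (xs v).head? = some (v, false)) (hlast : ∀ v, (xs v).getLast? = some (z v))
    (hz : ∀ v, σ (z v) = (v, true))
    (hmem : ∀ v, (((xs v).map S.hout ++ S.h₂ v :: m v : List H) : Cycle H) ∈ C)
    {v w : V} (hs : s (w, true) = (w, false)) :
    S.interlacement v w = passageMatrix σ s xs v w ∧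
      S.interlacement w v = - S.interlacement v w := by
  have hC' := hC.isCircuitPartition
  have hinj := S.hout_injective hF hC'
  have tel := List.sum_map_sub_of_isChain σ (fun x => if x = (w, true) then (1 : ℝ) else 0)
    (hchain v) (hhead v) (hlast v)
  have count : ∀ y : V × Bool, ((xs v).map fun x => if x = y then (1 : ℝ) else 0).sum =
      if y ∈ xs v then 1 else 0 := by
    intro y
    rw [List.sum_map_eq_sum_count_mul]
    simp only [mul_ite, mul_one, mul_zero, Finset.sum_ite_eq', Finset.mem_univ, if_true]
    rw [(hnd v).count]
    split_ifs <;> simp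
  have sub : ∀ (f g : V × Bool → ℝ) (l : List (V × Bool)),
      (l.map fun e => f e - g e).sum = (l.map f).sum - (l.map g).sum := by
    intro f g l
    induction l with
    | nil => simp
    | cons a l ih => simp only [List.map_cons, List.sum_cons, ih]; ring
  have entry : passageMatrix σ s xs v w = (if v = w then 1 else 0) +
      (if (w, true) ∈ xs v then 1 else 0) - (if (w, false) ∈ xs v then 1 else 0) := by
    rw [sub, count, hz] at tel
    rw [passageMatrix, Matrix.of_apply, sub, hs, count]
    have : (if (v, true) = (w, true) then (1 : ℝ) else 0) = if v = w then 1 else 0 := by simp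
    rw [this] at tel
    simp only [Prod.mk.injEq, Bool.false_eq_true, and_false, if_false] at tel
    linarith
  by_cases hvw : v = w
  · subst hvw
    have h1 : (v, false) ∈ xs v := List.mem_of_head? (hhead v)
    have h2 : (v, true) ∉ xs v := by
      intro h
      have h3 := Cycle.nodup_coe_iff.1 (hC'.1 _ (hmem v)).nodup
      rw [List.nodup_append] at h3
      exact h3.2.2 _ (List.mem_map_of_mem (f := S.hout) h) _ (List.mem_cons_self ..) rfl
    rw [entry, if_pos h1, if_neg h2]
    simp [interlacement]
  · have hhead' : ((xs v).map S.hout).head? = some (S.h₄ v) := by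
      rw [List.head?_map, hhead v]; rfl
    have conn : ∀ b d, ∀ c ∈ C, S.hout (w, b) ∈ c → S.hout (w, d) ∈ c := fun b d c hc h =>
      S.mem_circuit_of_hout (x := (w, b)) (y := (w, d)) hC (.refl _) hc h
    have ne : ∀ b d, S.hout (w, b) ≠ S.hout (v, d) := fun b d h => by
      have := hinj h
      simp at this
      exact hvw this.1.symm
    have A := S.inOrder_iff hC' (p := S.hout (w, true)) (q := S.hout (w, false)) hhead' (hmem v)
      (ne true false) (ne false true) (conn _ _)
    have B := S.inOrder_iff hC' (p := S.hout (w, false)) (q := S.hout (w, true)) hhead' (hmem v)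
      (ne false false) (ne true true) (conn _ _)
    rw [List.mem_map_of_injective hinj, List.mem_map_of_injective hinj] at A B
    refine ⟨?_, S.interlacement_transpose fun h => (A.1 h.1).2 (B.1 h.2).1⟩
    rw [entry, interlacement, Matrix.of_apply, if_neg hvw, if_neg hvw]
    have e2 : S.h₂ w = S.hout (w, true) := rfl
    have e4 : S.h₄ w = S.hout (w, false) := rfl
    simp only [e2, e4, A, B]
    split_ifs <;> first | tauto | simp

end Signing

end HalfEdgeGraph

open HalfEdgeGraph in
theorem mainTheorem8 {V H : Type*} [Fintype V] [DecidableEq V]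
    (F : HalfEdgeGraph V H) (hF : F.IsFourRegular)
    (C : Set (Cycle H)) (hC : F.IsEulerSystem C) (S : F.Signing C)
    (P : Set (Cycle H)) (hP : F.IsCircuitPartition P)
    (hψ : ∀ v, F.transition P v ≠ F.psi C v)
    [DecidablePred fun v => F.transition P v = F.chi C v] :
    List.TFAE [
      F.IsEulerSystem P,
      (S.stdMatrix hC P).det = 1,
      (S.stdMatrix hC P).det ≠ 0,
      (S.interlacementOf P).det = 1,
      (S.interlacementOf P).det ≠ 0] := by
  have hC' := hC.isCircuitPartition
  obtain ⟨σ, hσ⟩ := S.exists_perm hF hC'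
  obtain ⟨s, hs, hm⟩ := S.exists_swap hF hC' hP hψ
  have hs1 : ∀ x, (s x).1 = x.1 := fun x => by rw [hs]; split_ifs <;> rfl
  choose xs z m hxs hnd hchain hhead hlast hz hmem using S.exists_fundamental_walk hF hC hσ
  let st : Setoid V := ⟨F.Connected, connected_equivalence⟩
  let ρ : V → V := fun v => (Quotient.mk st v).out
  have hρ : ∀ v, F.Connected (ρ v) v := fun v => Quotient.exact (Quotient.out_eq (Quotient.mk st v))
  have hρ' : ∀ {v w}, F.Connected v w → ρ v = ρ w := fun h =>
    congrArg Quotient.out (Quotient.sound (s := st) h)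
  have hCE := (S.isEulerSystem_iff hF hC' hC' (s := 1) hσ (fun _ => rfl)
    (fun x => Or.inl (S.passage x))).1 hC
  rw [one_mul] at hCE
  have hPE := S.isEulerSystem_iff hF hC' hP hσ hs1 hm
  have hstd := S.stdMatrix_eq hF hC hP hσ hm hxs
  have hI := fun v w (hw : F.transition P w = F.chi C w) =>
    S.interlacement_eq hF hC (s := s) hnd hchain hhead hlast hz hmem (v := v) (w := w)
      (by rw [hs, if_pos hw]; rfl)
  obtain ⟨h1, h2⟩ := det_passageMatrix σ s xs ρ (fun v => F.transition P v = F.chi C v) hs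
    (fun v => hρ' (hρ v))
    (fun x => (hρ' (by simpa using S.connected_step (s := 1) hσ (fun _ => rfl) x)).symm)
    (fun v x hx => by
      apply hρ'
      have h1 : S.hout x ∈ (((xs v).map S.hout ++ S.h₂ v :: m v : List H) : Cycle H) := by
        rw [Cycle.mem_coe_iff, List.mem_append]
        exact Or.inl (List.mem_map_of_mem hx)
      have h2 := (hC.1 _ (hmem v)).choose_spec.change (Or.inl h1)
      have h3 := (h2.2 (S.hout (v, true))).1 (Or.inl (by simp [Signing.hout]))
      rwa [S.inc_hout, S.inc_hout] at h3)
    (fun v f => by rw [List.sum_map_sub_of_isChain σ f (hchain v) (hhead v) (hlast v), hz])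
    (fun x => by
      obtain ⟨n, -, hn⟩ := (hCE x (ρ x.1, true) (.symm _ _ (hρ x.1))).exists_pow_eq'
      exact ⟨n, hn⟩)
    (S.interlacementOf P)
    (by
      ext v w
      exact (hI v.1 w.1 w.2).1)
    (by
      ext v w
      exact (hI v.1 w.1 w.2).2)
  rw [← hstd] at h1
  have hpos : F.IsEulerSystem P → (S.interlacementOf P).det = 1 := by
    intro hE
    rw [h2]
    refine det_one_sub_cutMatrix_eq_one _ _ fun x => ?_
    obtain ⟨n, -, hn⟩ := (hPE.1 hE x (ρ x.1, true) (.symm _ _ (hρ x.1))).exists_pow_eq'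
    refine ⟨n, ?_⟩
    rw [hn, hρ' (hρ x.1)]
  have hneg : ¬ F.IsEulerSystem P → (S.interlacementOf P).det = 0 := by
    intro hE
    rw [h2]
    by_contra hdet
    have reach : ∀ x, (s * σ).SameCycle x (ρ x.1, true) := by
      intro x
      by_contra hx
      refine hdet (det_one_sub_cutMatrix_eq_zero _ _ (x := x) fun y hxy hy => hx ?_)
      rw [hρ' (S.connected_of_sameCycle hσ hs1 hxy), ← hy]
      exact hxy
    refine hE (hPE.2 fun x y hxy => ?_)
    have := reach y
    rw [← hρ' hxy] at this
    exact (reach x).trans this.symm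
  rw [h1]
  tfae_have 1 → 2 := hpos
  tfae_have 2 → 3 := fun h => by rw [h]; exact one_ne_zero
  tfae_have 3 → 1 := fun h => by_contra fun hE => h (hneg hE)
  tfae_have 2 → 4 := id
  tfae_have 4 → 5 := fun h => by rw [h]; exact one_ne_zero
  tfae_have 5 → 3 := id
  tfae_finish
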